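/- **Theorem (marked length spectrum rigidity).** *Definitions.* Let $G$ be a group acting by isometries on a metric space $(X,d)$. The space is geodesic if any two of its points are joined by a geodesic segment, i.e. by an isometrically embedded interval $[0,L]\to X$. For $Y\subseteq X$ and $x\in X$ put $\pi_Y(x)=\{y\in Y: d(x,y)\le d(x,Y)+1\}$. A subset $Y$ of a geodesic space is *contracting* if there is $C\ge 0$ such that $\operatorname{diam}\bigl(\bigcup_{x\in\alpha}\pi_Y(x)\bigr)\le C$ for every geodesic segment $\alpha$ with $d(\alpha,Y)\ge C$. Let $o\in X$. An element $h\in G$ is *contracting* if $\langle h\rangle o$ is a contracting subset and $n\mapsto h^n o$ is a quasi-isometric embedding $\mathbb Z\to X$. Two contracting elements $g,h$ are *weakly independent* if there is a function $\mathcal R:[0,\infty)\to[0,\infty)$ such that $\operatorname{diam}\bigl(N_r(\langle g\rangle o)\cap N_r(\langle h\rangle o)\bigr)\le\mathcal R(r)$ for all $r\ge 0$, where $N_r(A)=\{x\in X: d(x,A)\le r\}$. The action has the *contracting property* if $G$ contains two weakly independent contracting elements. The *marked length spectrum* is $\ell_d(g)=\lim_{n\to\infty}d(o,g^n o)/n$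 for $g\in G$. None of these notions depends on the choice of $o$. A map $f:(X,d)\to(Y,d_*)$ of metric spaces is a *rough isometry* if there is $c\ge 0$ with $|d_*(f(x),f(x'))-d(x,x')|\le c$ for all $x,x'\in X$, and there is a map $f':Y\to X$ with $\sup_{x}d(x,f'(f(x)))<\infty$ and $\sup_{y}d_*(y,f(f'(y)))<\infty$. If $G$ acts by isometries on $X$ and $Y$, the map $f$ is *$G$-coarsely equivariant* if $\sup_{x\in X,\,g\in G}d_*(f(gx),gf(x))<\infty$. The action on $X$ is *cobounded* if $X=\bigcup_{g\in G}gB$ for some bounded $B\subseteq X$. *Statement.* Let a group $G$ act isometrically on two (not necessarily proper) geodesic metric spaces $(X_1,d_1)$ and $(X_2,d_2)$, each action having the contracting property, and suppose that $\ell_{d_1}(g)=\ell_{d_2}(g)$ for every $g\in G$. Then for any basepoints $o_1\in X_1$ and $o_2\in X_2$, $$\sup_{g,h\in G}\bigl|d_1(go_1,ho_1)-d_2(go_2,ho_2)\bigr|<\infty .$$ Hence the orbit map $Go_1\to Go_2$, $go_1\mapsto go_2$, is well defined up to a bounded error, i.e. there is $K$ with $d_2(go_2,ho_2)\le K$ whenever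 $go_1=ho_1$; and it is a rough isometry, i.e. every map $\rho:Go_1\to Go_2$ that sends each $x\in Go_1$ to $go_2$ for some $g\in G$ with $go_1=x$ is a rough isometry. If moreover both actions are cobounded, then there is a $G$-coarsely equivariant rough isometry $X_1\to X_2$. -/

import Mathlib

open Filter Topology
open scoped NNReal ENNReal

namespace MLS

section Geometry

/-- `α` restricted to `[0, L]` is a geodesic segment of length `L`: an isometric embedding of the
interval `[0, L]`. Values of `α` outside `[0, L]` are irrelevant. -/
def IsGeodesicSegment {X : Type*} [MetricSpace X] (L : ℝ) (α : ℝ → X) : Prop :=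
  0 ≤ L ∧ ∀ s ∈ Set.Icc (0 : ℝ) L, ∀ t ∈ Set.Icc (0 : ℝ) L, dist (α s) (α t) = |s - t|

/-- Every two points of `X` are the endpoints of a geodesic segment. -/
def IsGeodesicSpace (X : Type*) [MetricSpace X] : Prop :=
  ∀ x y : X, ∃ (L : ℝ) (α : ℝ → X), IsGeodesicSegment L α ∧ α 0 = x ∧ α L = y

/-- The (coarsely) closest point projection of the point `x` to the subset `A`, a set-valued map:
`π_A(x) = {y ∈ A | d(x, y) ≤ d(x, A) + 1}`. It is non-empty for non-empty `A`, also when `X` is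
not proper. -/
def coarseProj {X : Type*} [MetricSpace X] (A : Set X) (x : X) : Set X :=
  {y | y ∈ A ∧ dist x y ≤ Metric.infDist x A + 1}

/-- `Y` is `C`-contracting: each geodesic segment `α` with `d(α, Y) ≥ C` has a projection
`π_Y(α) = ⋃ t, π_Y(α t)` of diameter at most `C`. -/
def IsContractingSubset {X : Type*} [MetricSpace X] (C : ℝ) (Y : Set X) : Prop :=
  ∀ (L : ℝ) (α : ℝ → X), IsGeodesicSegment L α →
    (∀ t ∈ Set.Icc (0 : ℝ) L, C ≤ Metric.infDist (α t) Y) →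
    Metric.ediam (⋃ t ∈ Set.Icc (0 : ℝ) L, coarseProj Y (α t)) ≤ ENNReal.ofReal C

/-- `Y` and `Z` have `R`-bounded intersection: `diam (N_r(Y) ∩ N_r(Z)) ≤ R(r)` for all `r ≥ 0`,
where `N_r` is the closed `r`-neighbourhood `{x | d(x, ·) ≤ r}`. -/
def HasBoundedIntersection {X : Type*} [MetricSpace X] (R : ℝ≥0 → ℝ≥0) (Y Z : Set X) : Prop :=
  ∀ r : ℝ≥0, Metric.ediam (Metric.cthickening (r : ℝ) Y ∩ Metric.cthickening (r : ℝ) Z) ≤ R r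

/-- `f` is a `(lam, c)`-quasi-isometric embedding. -/
def IsQuasiIsometricEmbedding {X Y : Type*} [MetricSpace X] [MetricSpace Y]
    (lam c : ℝ) (f : X → Y) : Prop :=
  1 ≤ lam ∧ 0 ≤ c ∧ ∀ x y : X,
    1 / lam * dist x y - c ≤ dist (f x) (f y) ∧ dist (f x) (f y) ≤ lam * dist x y + c

/-- `f` is a `(lam, c)`-quasi-isometry: a `(lam, c)`-quasi-isometric embedding with a
quasi-inverse. -/
def IsQuasiIsometry {X Y : Type*} [MetricSpace X] [MetricSpace Y]
    (lam c : ℝ) (f : X → Y) : Prop :=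
  IsQuasiIsometricEmbedding lam c f ∧
    ∃ f' : Y → X, (∃ K : ℝ, ∀ x, dist x (f' (f x)) ≤ K) ∧ ∃ K : ℝ, ∀ y, dist y (f (f' y)) ≤ K

/-- `f` is a rough isometry: a `(1, c)`-quasi-isometry for some `c ≥ 0`. -/
def IsRoughIsometry {X Y : Type*} [MetricSpace X] [MetricSpace Y] (f : X → Y) : Prop :=
  ∃ c : ℝ, IsQuasiIsometry 1 c f

end Geometry

section Actions

/-- The orbit `⟨h⟩ · o` of the cyclic group generated by `h`. -/
def cyclicOrbit {G X : Type*} [Group G] [MulAction G X] (h : G) (o : X) : Set X :=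
  Set.range fun n : ℤ => h ^ n • o

/-- `h` is a contracting element (with respect to the basepoint `o`): `⟨h⟩ · o` is a contracting
subset and `n ↦ hⁿ o` is a quasi-isometric embedding of `ℤ`. -/
def IsContractingElement {G X : Type*} [Group G] [MetricSpace X] [MulAction G X]
    (o : X) (h : G) : Prop :=
  (∃ C : ℝ, 0 ≤ C ∧ IsContractingSubset C (cyclicOrbit h o)) ∧
    ∃ lam c : ℝ, IsQuasiIsometricEmbedding lam c fun n : ℤ => h ^ n • o

/-- `⟨g⟩ · o` and `⟨h⟩ · o` have `R`-bounded intersection for some `R : [0, ∞) → [0, ∞)`. -/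
def AreWeaklyIndependent {G X : Type*} [Group G] [MetricSpace X] [MulAction G X]
    (o : X) (g h : G) : Prop :=
  ∃ R : ℝ≥0 → ℝ≥0, HasBoundedIntersection R (cyclicOrbit g o) (cyclicOrbit h o)

/-- The action of `G` on `X` has the contracting property: there are two weakly independent
contracting elements. (For isometric actions the choice of the basepoint is immaterial, because
orbits of a subgroup through two basepoints are at finite Hausdorff distance.) -/
def HasContractingProperty (G X : Type*) [Group G] [MetricSpace X] [MulAction G X] : Prop :=
  ∃ (o : X) (g h : G),
    IsContractingElement o g ∧ IsContractingElement o h ∧ AreWeaklyIndependent o g h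

/-- The stable translation length `ℓ(g) = lim d(o, gⁿ o) / n`. The limit exists and does not
depend on `o`, see `tendsto_stableLength` and `stableLength_eq`. -/
noncomputable def stableLength {G X : Type*} [Group G] [MetricSpace X] [MulAction G X]
    (o : X) (g : G) : ℝ :=
  limUnder atTop fun n : ℕ => dist o (g ^ n • o) / (n : ℝ)

theorem tendsto_stableLength {G X : Type*} [Group G] [MetricSpace X] [MulAction G X]
    [IsIsometricSMul G X] (o : X) (g : G) :
    Tendsto (fun n : ℕ => dist o (g ^ n • o) / (n : ℝ)) atTop (𝓝 (stableLength o g)) := by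
  have hs : Subadditive fun n : ℕ => dist o (g ^ n • o) := by
    intro m n
    calc dist o (g ^ (m + n) • o)
        ≤ dist o (g ^ m • o) + dist (g ^ m • o) (g ^ (m + n) • o) := dist_triangle _ _ _
      _ = dist o (g ^ m • o) + dist o (g ^ n • o) := by rw [pow_add, mul_smul, dist_smul]
  refine tendsto_nhds_limUnder ⟨_, hs.tendsto_lim ⟨0, ?_⟩⟩
  rintro _ ⟨n, rfl⟩
  positivity

theorem stableLength_eq {G X : Type*} [Group G] [MetricSpace X] [MulAction G X]
    [IsIsometricSMul G X] (o o' : X) (g : G) : stableLength o g = stableLength o' g := by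
  have h := (tendsto_stableLength o g).sub (tendsto_stableLength o' g)
  have h0 : Tendsto (fun n : ℕ => dist o (g ^ n • o) / (n : ℝ) - dist o' (g ^ n • o') / (n : ℝ))
      atTop (𝓝 0) := by
    refine squeeze_zero_norm (fun n => ?_)
      (tendsto_const_div_atTop_nhds_zero_nat (dist o o' + dist o o'))
    rw [← sub_div, norm_div, Real.norm_natCast, Real.norm_eq_abs, ← Real.dist_eq]
    gcongr
    have := dist_dist_dist_le o (g ^ n • o) o' (g ^ n • o')
    rwa [dist_smul] at this
  exact sub_eq_zero.1 (tendsto_nhds_unique h h0)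

/-- `ρ` is an orbit map `Go₁ → Go₂`, `go₁ ↦ go₂`: it sends each point `x` of `Go₁` to `go₂` for
some `g` with `go₁ = x`. -/
def IsOrbitMap {G X₁ X₂ : Type*} [Group G] [MulAction G X₁] [MulAction G X₂] (o₁ : X₁) (o₂ : X₂)
    (ρ : MulAction.orbit G o₁ → MulAction.orbit G o₂) : Prop :=
  ∀ x : MulAction.orbit G o₁, ∃ g : G, g • o₁ = (x : X₁) ∧ (ρ x : X₂) = g • o₂

/-- The action is cobounded: the translates of some bounded set cover `X`. -/
def IsCobounded (G X : Type*) [Group G] [MetricSpace X] [MulAction G X] : Prop :=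
  ∃ B : Set X, Bornology.IsBounded B ∧ ∀ x : X, ∃ g : G, ∃ b ∈ B, g • b = x

/-- `f` is `G`-coarsely equivariant: `d(f(gx), g f(x))` is bounded in `x` and `g`. -/
def IsCoarselyEquivariant (G : Type*) {X Y : Type*} [Group G] [MetricSpace X] [MetricSpace Y]
    [MulAction G X] [MulAction G Y] (f : X → Y) : Prop :=
  ∃ K : ℝ, ∀ (g : G) (x : X), dist (f (g • x)) (g • f x) ≤ K

end Actions

end MLS

/-! Displacement can be recovered from stable length up to a bounded error. One always has `ℓ(g) ≤
d(o, g o)`; the heart of the proof is a converse: there are a finite `F ⊆ G` and a constant `Q` such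
that each `g` has some `f ∈ F` with `d(o, g o) ≤ ℓ(g f) + Q`
(`HasContractingProperty.exists_dist_le_stableLength`). Then `d₁(o₁, g o₁) ≤ ℓ₁(g f) + Q = ℓ₂(g f) +
Q ≤ d₂(o₂, g o₂) + d₂(o₂, f o₂) + Q`, and `F` is finite. Exchange the actions and translate by `g⁻¹`
to compare all distances.

For the converse, let `a` and `b` be weakly independent contracting elements. If `g o` and `g⁻¹ o`
project near `o` to `⟨a⟩ o`, a large power `aⁿ` separates projections enough that geodesics from `o`
to `(g aⁿ)ᴷ o` lose only a bounded length per factor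
(`IsContractingElement.exists_dist_sub_le_stableLength`). For arbitrary `g`, a Behrstock inequality
shows that multiplying by a fixed power of `b`, where needed, on either side gives this position;
conjugation absorbs the left factor. -/

namespace MLS

/-! ### Projections to contracting subsets -/

section ContractingSubsets

variable {X : Type*} [MetricSpace X]

theorem IsGeodesicSegment.subsegment {L : ℝ} {α : ℝ → X} (hα : IsGeodesicSegment L α) {a b : ℝ}
    (ha : 0 ≤ a) (hab : a ≤ b) (hb : b ≤ L) :
    IsGeodesicSegment (b - a) fun s => α (a + s) := by
  refine ⟨by linarith, fun s hs t ht => ?_⟩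
  rw [hα.2 _ ⟨by linarith [hs.1], by linarith [hs.2]⟩ _ ⟨by linarith [ht.1], by linarith [ht.2]⟩]
  congr 1
  ring

theorem IsGeodesicSegment.reverse {L : ℝ} {α : ℝ → X} (hα : IsGeodesicSegment L α) :
    IsGeodesicSegment L fun s => α (L - s) := by
  refine ⟨hα.1, fun s hs t ht => ?_⟩
  rw [hα.2 _ ⟨by linarith [hs.2], by linarith [hs.1]⟩ _ ⟨by linarith [ht.2], by linarith [ht.1]⟩,
    abs_sub_comm]
  congr 1
  ring

theorem IsGeodesicSegment.dist_add_dist {L : ℝ} {α : ℝ → X} (hα : IsGeodesicSegment L α) {t : ℝ}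
    (ht : t ∈ Set.Icc 0 L) : dist (α 0) (α t) + dist (α t) (α L) = dist (α 0) (α L) := by
  rw [hα.2 0 ⟨le_rfl, hα.1⟩ t ht, hα.2 t ht L ⟨hα.1, le_rfl⟩,
    hα.2 0 ⟨le_rfl, hα.1⟩ L ⟨hα.1, le_rfl⟩, abs_sub_comm 0 t, abs_sub_comm t L, abs_sub_comm 0 L,
    abs_of_nonneg (by linarith [ht.1]), abs_of_nonneg (by linarith [ht.2]),
    abs_of_nonneg (by linarith [hα.1])]
  ring

theorem IsGeodesicSegment.smul {G : Type*} [Group G] [MulAction G X] [IsIsometricSMul G X]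
    {L : ℝ} {α : ℝ → X} (hα : IsGeodesicSegment L α) (g : G) :
    IsGeodesicSegment L fun s => g • α s :=
  ⟨hα.1, fun s hs t ht => by rw [dist_smul, hα.2 s hs t ht]⟩

theorem coarseProj_nonempty {A : Set X} (hA : A.Nonempty) (x : X) : (coarseProj A x).Nonempty := by
  obtain ⟨y, hy, hxy⟩ := (Metric.infDist_lt_iff hA).1 (lt_add_one (Metric.infDist x A))
  exact ⟨y, hy, hxy.le⟩

theorem mem_coarseProj_self {A : Set X} {x : X} (hx : x ∈ A) : x ∈ coarseProj A x :=
  ⟨hx, by rw [dist_self]; linarith [Metric.infDist_nonneg (x := x) (s := A)]⟩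

theorem dist_le_one_of_mem_coarseProj {A : Set X} {x y : X} (hx : x ∈ A)
    (hy : y ∈ coarseProj A x) : dist x y ≤ 1 := by
  have := hy.2
  rwa [Metric.infDist_zero_of_mem hx, zero_add] at this

theorem IsContractingSubset.mono {C C' : ℝ} {A : Set X} (hA : IsContractingSubset C A)
    (h : C ≤ C') : IsContractingSubset C' A := fun L α hα hd =>
  (hA L α hα fun t ht => h.trans (hd t ht)).trans (ENNReal.ofReal_le_ofReal h)

theorem IsContractingSubset.dist_le {C : ℝ} (hC : 0 ≤ C) {A : Set X}
    (hA : IsContractingSubset C A) {L : ℝ} {α : ℝ → X} (hα : IsGeodesicSegment L α)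
    (hd : ∀ t ∈ Set.Icc (0 : ℝ) L, C ≤ Metric.infDist (α t) A) {s t : ℝ}
    (hs : s ∈ Set.Icc (0 : ℝ) L) (ht : t ∈ Set.Icc (0 : ℝ) L) {y z : X}
    (hy : y ∈ coarseProj A (α s)) (hz : z ∈ coarseProj A (α t)) : dist y z ≤ C := by
  rw [← edist_le_ofReal hC]
  exact (Metric.edist_le_ediam_of_mem (Set.mem_biUnion hs hy) (Set.mem_biUnion ht hz)).trans
    (hA L α hα hd)

/-- A geodesic that comes close to a contracting subset does so first near the projection of its
initial point. -/
theorem IsContractingSubset.exists_dist_initial_le {C : ℝ} (hC : 0 ≤ C) {A : Set X}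
    (hA : IsContractingSubset C A) {L : ℝ} {α : ℝ → X} (hα : IsGeodesicSegment L α) {y : X}
    (hy : y ∈ coarseProj A (α 0)) (h : ∃ t ∈ Set.Icc (0 : ℝ) L, Metric.infDist (α t) A < C) :
    ∃ t ∈ Set.Icc (0 : ℝ) L, dist (α t) y ≤ 2 * C + 3 := by
  have hne : A.Nonempty := ⟨y, hy.1⟩
  set S : Set ℝ := {t | t ∈ Set.Icc (0 : ℝ) L ∧ Metric.infDist (α t) A < C} with hS
  have hSne : S.Nonempty := by
    obtain ⟨t, ht, htC⟩ := h
    exact ⟨t, ht, htC⟩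
  have hSb : BddBelow S := ⟨0, fun t ht => ht.1.1⟩
  obtain ⟨u, hu, hu'⟩ := Real.lt_sInf_add_pos hSne one_pos
  have h0 : 0 ≤ sInf S := le_csInf hSne fun t ht => ht.1.1
  have huS : sInf S ≤ u := csInf_le hSb hu
  obtain ⟨⟨hu0, huL⟩, huC⟩ := hu
  by_cases h1 : sInf S ≤ 1
  · refine ⟨0, ⟨le_rfl, hα.1⟩, ?_⟩
    have h2 : Metric.infDist (α 0) A ≤ Metric.infDist (α u) A + dist (α 0) (α u) :=
      Metric.infDist_le_infDist_add_dist
    rw [hα.2 0 ⟨le_rfl, hα.1⟩ u ⟨hu0, huL⟩, zero_sub, abs_neg, abs_of_nonneg hu0] at h2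
    linarith [hy.2]
  · push Not at h1
    -- One unit before the first approach: `[0, v]` avoids `S`, so its projection is small, while `α
    -- v` is still within `C + 2` of `A`.
    set v := sInf S - 1 with hv
    have hvI : v ∈ Set.Icc (0 : ℝ) L := ⟨by linarith, by linarith⟩
    refine ⟨v, hvI, ?_⟩
    have h2 : Metric.infDist (α v) A ≤ Metric.infDist (α u) A + dist (α v) (α u) :=
      Metric.infDist_le_infDist_add_dist
    rw [hα.2 v hvI u ⟨hu0, huL⟩, abs_sub_comm, abs_of_nonneg (by linarith)] at h2
    obtain ⟨z, hz⟩ := coarseProj_nonempty hne (α v)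
    have hαv : IsGeodesicSegment v α :=
      ⟨hvI.1, fun s hs t ht => hα.2 s ⟨hs.1, hs.2.trans hvI.2⟩ t ⟨ht.1, ht.2.trans hvI.2⟩⟩
    have h3 : dist z y ≤ C := by
      refine hA.dist_le hC hαv (fun t ht => ?_) ⟨hvI.1, le_rfl⟩ ⟨le_rfl, hvI.1⟩ hz hy
      by_contra hlt
      have : sInf S ≤ t := csInf_le hSb ⟨⟨ht.1, ht.2.trans hvI.2⟩, not_le.1 hlt⟩
      linarith [ht.2]
    linarith [dist_triangle (α v) z y, hz.2]

/-- A geodesic whose endpoints have distant projections passes near the projection of its initial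
point. -/
theorem IsContractingSubset.exists_dist_proj_le {C : ℝ} (hC : 0 ≤ C) {A : Set X}
    (hA : IsContractingSubset C A) {L : ℝ} {α : ℝ → X} (hα : IsGeodesicSegment L α) {y z : X}
    (hy : y ∈ coarseProj A (α 0)) (hz : z ∈ coarseProj A (α L)) (h : C < dist y z) :
    ∃ t ∈ Set.Icc (0 : ℝ) L, dist (α t) y ≤ 2 * C + 3 := by
  refine hA.exists_dist_initial_le hC hα hy ?_
  by_contra! hd
  exact h.not_ge (hA.dist_le hC hα hd ⟨le_rfl, hα.1⟩ ⟨hα.1, le_rfl⟩ hy hz)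

theorem IsContractingSubset.exists_dist_proj_le' {C : ℝ} (hC : 0 ≤ C) {A : Set X}
    (hA : IsContractingSubset C A) {L : ℝ} {α : ℝ → X} (hα : IsGeodesicSegment L α) {y z : X}
    (hy : y ∈ coarseProj A (α 0)) (hz : z ∈ coarseProj A (α L)) (h : C < dist y z) :
    ∃ t ∈ Set.Icc (0 : ℝ) L, dist (α t) z ≤ 2 * C + 3 := by
  obtain ⟨t, ht, htz⟩ := hA.exists_dist_proj_le hC hα.reverse (y := z) (z := y)
    (by simpa using hz) (by simpa using hy) (by rwa [dist_comm])
  exact ⟨L - t, ⟨by linarith [ht.2], by linarith [ht.1]⟩, htz⟩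

/-- The projection to a contracting subset is coarsely Lipschitz. -/
theorem IsContractingSubset.dist_proj_le {C : ℝ} (hC : 0 ≤ C) (hX : IsGeodesicSpace X) {A : Set X}
    (hA : IsContractingSubset C A) {x x' y y' : X} (hy : y ∈ coarseProj A x)
    (hy' : y' ∈ coarseProj A x') : dist y y' ≤ dist x x' + (4 * C + 6) := by
  by_cases h : C < dist y y'
  · obtain ⟨L, α, hα, rfl, rfl⟩ := hX x x'
    obtain ⟨s, hs, hsy⟩ := hA.exists_dist_proj_le hC hα hy hy' h
    obtain ⟨t, ht, hty⟩ := hA.exists_dist_proj_le' hC hα hy hy' h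
    have h1 : dist (α s) (α t) ≤ dist (α 0) (α L) := by
      rw [hα.2 s hs t ht, hα.2 0 ⟨le_rfl, hα.1⟩ L ⟨hα.1, le_rfl⟩, zero_sub, abs_neg,
        abs_of_nonneg hα.1, abs_le]
      constructor <;> linarith [hs.1, hs.2, ht.1, ht.2]
    linarith [dist_triangle4 y (α s) (α t) y', dist_comm y (α s)]
  · linarith [dist_nonneg (x := x) (y := x')]

/-- Contracting subsets are quasiconvex. -/
theorem IsContractingSubset.infDist_le {C : ℝ} (hC : 0 < C) {A : Set X}
    (hA : IsContractingSubset C A) {L : ℝ} {α : ℝ → X} (hα : IsGeodesicSegment L α)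
    (h0 : α 0 ∈ A) (hL : α L ∈ A) {t : ℝ} (ht : t ∈ Set.Icc (0 : ℝ) L) :
    Metric.infDist (α t) A ≤ 6 * C + 9 := by
  obtain ⟨y, hy⟩ := coarseProj_nonempty ⟨_, h0⟩ (α t)
  -- Both halves of `α`, started at `α t`, end on `A`, so both pass within `2 * C + 3` of `y`, at
  -- times `u` and `v`. As `α` is geodesic, `u + v ≤ 4 * C + 6`.
  obtain ⟨u, hu, huy⟩ := hA.exists_dist_initial_le hC.le (hα.subsegment ht.1 ht.2 le_rfl)
    (y := y) (by simpa using hy)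
    ⟨L - t, ⟨by linarith [ht.2], le_rfl⟩, by simpa [Metric.infDist_zero_of_mem hL] using hC⟩
  obtain ⟨v, hv, hvy⟩ := hA.exists_dist_initial_le hC.le (L := t)
    (by simpa using (hα.subsegment le_rfl ht.1 ht.2).reverse)
    (y := y) (by simpa using hy)
    ⟨t, ⟨ht.1, le_rfl⟩, by simpa [Metric.infDist_zero_of_mem h0] using hC⟩
  have h1 : dist (α (t + u)) (α (t - v)) = u + v := by
    rw [hα.2 _ ⟨by linarith [hu.1, ht.1], by linarith [hu.2]⟩ _
      ⟨by linarith [hv.2], by linarith [hv.1, ht.2]⟩, abs_of_nonneg (by linarith [hu.1, hv.1])]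
    ring
  have h2 : dist (α t) (α (t + u)) = u := by
    rw [hα.2 _ ht _ ⟨by linarith [hu.1, ht.1], by linarith [hu.2]⟩, abs_sub_comm,
      abs_of_nonneg (by linarith [hu.1])]
    ring
  linarith [dist_triangle_right (α (t + u)) (α (t - v)) y, hv.1,
    Metric.infDist_le_dist_of_mem (x := α t) hy.1, dist_triangle (α t) (α (t + u)) y]

/-- If contracting subsets `A` and `B` with bounded intersection have a common point, then `B` has
bounded projection to `A`. -/
theorem exists_dist_proj_le_of_boundedIntersection {C : ℝ} (hC : 0 < C) (hX : IsGeodesicSpace X)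
    {A B : Set X} (hA : IsContractingSubset C A) (hB : IsContractingSubset C B)
    {R : ℝ≥0 → ℝ≥0} (hR : HasBoundedIntersection R A B) {o : X} (hoA : o ∈ A) (hoB : o ∈ B) :
    ∃ D : ℝ, ∀ b ∈ B, ∀ y ∈ coarseProj A b, dist o y ≤ D := by
  -- `2 * C + 3` from `y` to the geodesic, `6 * C + 9` from there to `B` by quasiconvexity, and `1`
  -- because the infimum need not be attained.
  set r : ℝ≥0 := ⟨8 * C + 13, by positivity⟩ with hr
  have hrC : (r : ℝ) = 8 * C + 13 := rfl
  refine ⟨max C (R r), fun b hb y hy => ?_⟩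
  by_cases h : C < dist o y
  · refine le_max_of_le_right ?_
    obtain ⟨L, α, hα, rfl, rfl⟩ := hX o b
    obtain ⟨t, ht, hty⟩ := hA.exists_dist_proj_le' hC.le hα (mem_coarseProj_self hoA) hy h
    have h1 := hB.infDist_le hC hα hoB hb ht
    obtain ⟨z, hz, hzt⟩ :=
      (Metric.infDist_lt_iff ⟨_, hoB⟩).1 (h1.trans_lt (lt_add_one (6 * C + 9)))
    have h2 : y ∈ Metric.cthickening (r : ℝ) B := by
      refine Metric.mem_cthickening_of_dist_le y z _ B hz ?_
      rw [hrC]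
      linarith [dist_triangle_left y z (α t)]
    have h3 := (Metric.edist_le_ediam_of_mem
      (Set.mem_inter (Metric.self_subset_cthickening A hoA) (Metric.self_subset_cthickening B hoB))
      (Set.mem_inter (Metric.self_subset_cthickening A hy.1) h2)).trans (hR r)
    rw [← ENNReal.ofReal_coe_nnreal] at h3
    exact (edist_le_ofReal (R r).coe_nonneg).1 h3
  · exact le_max_of_le_left (not_lt.1 h)

/-- A Behrstock inequality: no point projects far from a common point `o` to both of two contracting
subsets with bounded intersection. -/
theorem exists_dist_proj_le_or_dist_proj_le {C : ℝ} (hC : 0 < C) (hX : IsGeodesicSpace X)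
    {A B : Set X} (hA : IsContractingSubset C A) (hB : IsContractingSubset C B)
    {R : ℝ≥0 → ℝ≥0} (hR : HasBoundedIntersection R A B) {o : X} (hoA : o ∈ A) (hoB : o ∈ B) :
    ∃ D : ℝ, 0 ≤ D ∧ ∀ x, ∀ y ∈ coarseProj A x, ∀ z ∈ coarseProj B x,
      dist o y ≤ D ∨ dist o z ≤ D := by
  obtain ⟨D, hD⟩ := exists_dist_proj_le_of_boundedIntersection hC hX hA hB hR hoA hoB
  have hD0 : 0 ≤ D := dist_nonneg.trans (hD o hoB o (mem_coarseProj_self hoA))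
  refine ⟨4 * C + 7 + 2 * D, by positivity, fun x y hy z hz => ?_⟩
  by_contra! hcon
  -- `w` is near `o`, so if `y` is far, a geodesic from `x` to `z` passes near `o`. As `z` is almost
  -- closest to `x` in `B ∋ o`, it cannot continue far beyond `o`.
  obtain ⟨w, hw⟩ := coarseProj_nonempty ⟨o, hoA⟩ z
  have hwD := hD z hz.1 w hw
  obtain ⟨L, α, hα, rfl, rfl⟩ := hX x z
  obtain ⟨t, ht, htw⟩ := hA.exists_dist_proj_le' hC.le hα hy hw
    (by linarith [dist_triangle_right o y w, dist_comm w y])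
  linarith [hα.dist_add_dist ht, hz.2, Metric.infDist_le_dist_of_mem (x := α 0) hoB,
    dist_triangle (α 0) (α t) o, dist_triangle (α t) w o, dist_comm o w,
    dist_triangle o (α t) (α L), dist_comm o (α t)]

end ContractingSubsets

/-! ### Contracting elements and stable length -/

section ContractingElements

theorem mem_cyclicOrbit {G X : Type*} [Group G] [MulAction G X] (h : G) (o : X) : o ∈ cyclicOrbit h o := ⟨0, by simp⟩

theorem smul_image_cyclicOrbit {G X : Type*} [Group G] [MulAction G X] (h : G) (o : X) (n : ℤ) :
    (fun x => h ^ n • x) '' cyclicOrbit h o = cyclicOrbit h o := by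
  ext x
  constructor
  · rintro ⟨_, ⟨m, rfl⟩, rfl⟩
    exact ⟨n + m, by simp [zpow_add, mul_smul]⟩
  · rintro ⟨m, rfl⟩
    exact ⟨h ^ (m - n) • o, ⟨m - n, rfl⟩, by simp [← mul_smul, ← zpow_add]⟩

variable {G X : Type*} [Group G] [MetricSpace X] [MulAction G X]

theorem smul_mem_coarseProj_cyclicOrbit [IsIsometricSMul G X] {h : G} {o x y : X}
    (hy : y ∈ coarseProj (cyclicOrbit h o) x) (n : ℤ) :
    h ^ n • y ∈ coarseProj (cyclicOrbit h o) (h ^ n • x) := by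
  refine ⟨?_, ?_⟩
  · rw [← smul_image_cyclicOrbit h o n]
    exact ⟨y, hy.1, rfl⟩
  · have h1 := Metric.infDist_image (isometry_smul X (h ^ n)) (x := x) (t := cyclicOrbit h o)
    rw [smul_image_cyclicOrbit] at h1
    rw [dist_smul, h1]
    exact hy.2

theorem IsContractingElement.exists_lt_dist {o : X} {h : G} (hh : IsContractingElement o h)
    (D : ℝ) : ∃ n : ℤ, D < dist o (h ^ n • o) := by
  obtain ⟨-, lam, c, hlam, hc, hq⟩ := hh
  obtain ⟨n, hn⟩ := exists_nat_gt (lam * (D + c))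
  refine ⟨n, ?_⟩
  have h1 := (hq 0 n).1
  have h2 : D + c < 1 / lam * n := by
    rw [one_div, inv_mul_eq_div, lt_div_iff₀ (by linarith)]
    linarith
  simp only [zpow_zero, one_smul, Int.dist_eq, Int.cast_zero, Int.cast_natCast, zero_sub, abs_neg,
    Nat.abs_cast] at h1
  linarith

theorem stableLength_conj [IsIsometricSMul G X] (o : X) (g k : G) :
    stableLength o (k * g * k⁻¹) = stableLength o g := by
  rw [stableLength_eq o (k⁻¹ • o) g, stableLength, stableLength]
  congr 1
  ext n
  rw [conj_pow, ← dist_smul k (k⁻¹ • o)]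
  simp [mul_smul]

theorem stableLength_le_dist [IsIsometricSMul G X] (o : X) (g : G) :
    stableLength o g ≤ dist o (g • o) := by
  refine le_of_tendsto (tendsto_stableLength o g) ?_
  filter_upwards [eventually_gt_atTop 0] with n hn
  rw [div_le_iff₀ (by exact_mod_cast hn), mul_comm]
  clear hn
  induction n with
  | zero => simp
  | succ n ih =>
    have h1 : dist (g ^ n • o) (g ^ (n + 1) • o) = dist o (g • o) := by
      rw [pow_succ, mul_smul, dist_smul]
    push_cast
    linarith [dist_triangle o (g ^ n • o) (g ^ (n + 1) • o)]

theorem le_stableLength [IsIsometricSMul G X] {o : X} {g : G} {r : ℝ}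
    (h : ∀ n : ℕ, n * r ≤ dist o (g ^ n • o)) : r ≤ stableLength o g := by
  refine ge_of_tendsto (tendsto_stableLength o g) ?_
  filter_upwards [eventually_gt_atTop 0] with n hn
  rw [le_div_iff₀ (by exact_mod_cast hn), mul_comm]
  exact h n

/-- If `g o` and `g⁻¹ o` project near `o` to the axis of the contracting element `a`, then the
stable length of `g aⁿ` is almost the displacement of `g`, for a suitable `n`. -/
theorem IsContractingElement.exists_dist_sub_le_stableLength [IsIsometricSMul G X]
    (hX : IsGeodesicSpace X) {o : X} {a : G} (ha : IsContractingElement o a) {D : ℝ}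
    (hD : 0 ≤ D) :
    ∃ (n : ℤ) (Q : ℝ), ∀ g : G,
      (∃ p ∈ coarseProj (cyclicOrbit a o) (g • o), dist o p ≤ D) →
      (∃ p ∈ coarseProj (cyclicOrbit a o) (g⁻¹ • o), dist o p ≤ D) →
      dist o (g • o) - Q ≤ stableLength o (g * a ^ n) := by
  obtain ⟨C, hC, hA⟩ := ha.1
  set A := cyclicOrbit a o with hAdef
  have hoA : o ∈ A := mem_cyclicOrbit a o
  set E := 2 * C + 3 + D with hE
  set E₂ := D + E + (4 * C + 6) with hE₂
  set D' := E₂ + C with hD'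
  -- Points projecting within `D'` of `o` are moved by `aⁿ` to points projecting more than `C` from
  -- every `p` with `dist o p ≤ D`.
  obtain ⟨n, hn⟩ := ha.exists_lt_dist (D + D' + C)
  set f := a ^ n with hf
  set Q := (E + (2 * C + 3) + E₂) + (2 * E + dist o (f • o)) with hQ
  refine ⟨n, Q, ?_⟩
  rintro g ⟨p', hp', hp'D⟩ ⟨p, hp, hpD⟩
  refine le_stableLength fun K => ?_
  have hfo : 0 ≤ dist o (f • o) := dist_nonneg
  by_cases hgQ : dist o (g • o) ≤ Q
  · exact (mul_nonpos_of_nonneg_of_nonpos (by positivity) (by linarith)).trans dist_nonneg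
  push Not at hgQ
  -- The projection bound is carried through the induction because it forces the next geodesic to
  -- pass near `g • o`.
  suffices H : (∀ y ∈ coarseProj A ((g * f) ^ K • o), dist o y ≤ D') ∧
      K * (dist o (g • o) - Q) ≤ dist o ((g * f) ^ K • o) from H.2
  induction K with
  | zero =>
    refine ⟨fun y hy => ?_, by simp⟩
    have := dist_le_one_of_mem_coarseProj hoA (y := y) (by simpa using hy)
    linarith
  | succ K ih =>
    obtain ⟨ih₁, ih₂⟩ := ih
    have hw : (g * f) ^ (K + 1) • o = g • f • (g * f) ^ K • o := by
      rw [pow_succ', mul_smul, mul_smul]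
    set x := (g * f) ^ K • o with hx
    rw [hw]
    obtain ⟨q, hq⟩ := coarseProj_nonempty ⟨o, hoA⟩ x
    have hfq : f • q ∈ coarseProj A (f • x) := smul_mem_coarseProj_cyclicOrbit hq n
    obtain ⟨L, α, hα, hα0, hαL⟩ := hX (g⁻¹ • o) (f • x)
    have hpq : C < dist p (f • q) := by
      have h1 : dist (f • q) (f • o) = dist o q := by rw [dist_smul, dist_comm]
      linarith [dist_triangle4 o p (f • q) (f • o), ih₁ q hq]
    obtain ⟨t, ht, htp⟩ := hA.exists_dist_proj_le hC hα (by rwa [hα0]) (by rwa [hαL]) hpq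
    have hto : dist (g • α t) (g • o) ≤ E := by
      rw [dist_smul]
      linarith [dist_triangle (α t) p o, dist_comm o p]
    have hβ := hα.smul g
    have hβ0 : g • α 0 = o := by rw [hα0, smul_inv_smul]
    have hβL : g • α L = g • f • x := by rw [hαL]
    have hsplit := hβ.dist_add_dist ht
    simp only [hβ0, hβL] at hsplit
    have ho1 : dist o (g • o) ≤ dist o (g • α t) + E := by
      linarith [dist_triangle o (g • α t) (g • o)]
    refine ⟨fun y hy => ?_, ?_⟩
    -- Otherwise the geodesic, after passing near `g • o`, would return near `p₂`, hence near `o`,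
    -- contradicting `Q < dist o (g • o)`.
    · by_contra! hyD
      obtain ⟨p₂, hp₂⟩ := coarseProj_nonempty ⟨o, hoA⟩ (g • α t)
      have h1 := hA.dist_proj_le hC hX hp' hp₂
      have hp₂E : dist o p₂ ≤ E₂ := by
        linarith [dist_triangle o p' p₂, dist_comm (g • α t) (g • o)]
      obtain ⟨s, hs, hsp⟩ := hA.exists_dist_proj_le hC (hβ.subsegment ht.1 ht.2 le_rfl)
        (y := p₂) (z := y) (by simpa using hp₂) (by simpa [hβL] using hy)
        (by linarith [dist_triangle o p₂ y])
      have h2 : dist o (g • α t) ≤ dist o (g • α (t + s)) := by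
        have hts : t + s ∈ Set.Icc 0 L := ⟨by linarith [ht.1, hs.1], by linarith [hs.2]⟩
        have e1 := hβ.2 0 ⟨le_rfl, hα.1⟩ t ht
        have e2 := hβ.2 0 ⟨le_rfl, hα.1⟩ (t + s) hts
        simp only [hβ0, zero_sub, abs_neg] at e1 e2
        rw [e1, e2, abs_of_nonneg ht.1, abs_of_nonneg hts.1]
        linarith [hs.1]
      linarith [dist_triangle o p₂ (g • α (t + s)), dist_comm (g • α (t + s)) p₂]
    · have h1 : dist (g • o) (g • f • x) = dist o (f • x) := dist_smul _ _ _
      have h2 : dist (f • o) (f • x) = dist o x := dist_smul _ _ _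
      push_cast
      linarith [dist_triangle (g • o) (g • α t) (g • f • x), dist_comm (g • α t) (g • o),
        dist_triangle_left (f • o) (f • x) o]

/-- Up to composition with an element of a finite set, the stable length of each element is almost
its displacement. -/
theorem HasContractingProperty.exists_dist_le_stableLength [IsIsometricSMul G X]
    (hX : IsGeodesicSpace X) (hc : HasContractingProperty G X) (o : X) :
    ∃ (F : Finset G) (Q : ℝ), ∀ g : G, ∃ f ∈ F, dist o (g • o) ≤ stableLength o (g * f) + Q := by
  classical
  obtain ⟨p, a, b, ha, hb, R, hR⟩ := hc
  obtain ⟨C₁, hC₁, hA₁⟩ := ha.1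
  obtain ⟨C₂, hC₂, hB₂⟩ := hb.1
  set C := C₁ + C₂ + 1 with hCdef
  have hC : 0 < C := by positivity
  have hA := hA₁.mono (show C₁ ≤ C by linarith)
  have hB := hB₂.mono (show C₂ ≤ C by linarith)
  have hpA := mem_cyclicOrbit a p
  have hpB := mem_cyclicOrbit b p
  obtain ⟨D, hD0, hD⟩ := exists_dist_proj_le_or_dist_proj_le hC hX hA hB hR hpA hpB
  obtain ⟨m, hm⟩ := hb.exists_lt_dist (2 * D)
  set k := b ^ m with hk
  have hsel : ∀ x : X, ∃ h ∈ ({1, k} : Finset G),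
      ∀ y ∈ coarseProj (cyclicOrbit a p) (h • x), dist p y ≤ D := by
    intro x
    by_cases h : ∀ y ∈ coarseProj (cyclicOrbit a p) x, dist p y ≤ D
    · exact ⟨1, by simp, by simpa using h⟩
    · push Not at h
      obtain ⟨y, hy, hyD⟩ := h
      -- Here `x` projects within `D` of `p` to the axis of `b`. Since `k` moves `p` by more than `2
      -- * D`, `k • x` projects far from `p` there, hence near `p` on the axis of `a`.
      refine ⟨k, by simp, fun y' hy' => ?_⟩
      obtain ⟨z, hz⟩ := coarseProj_nonempty ⟨p, hpB⟩ x
      have hzD := (hD x y hy z hz).resolve_left hyD.not_ge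
      refine (hD _ y' hy' _ (smul_mem_coarseProj_cyclicOrbit hz m)).resolve_right ?_
      have h1 : dist (k • z) (k • p) = dist p z := by rw [dist_smul, dist_comm]
      rw [not_le, ← hk]
      linarith [dist_triangle p (k • z) (k • p)]
  set M := dist p (k • p) with hM
  have hM0 : 0 ≤ M := dist_nonneg
  have hdisp : ∀ h ∈ ({1, k} : Finset G), dist p (h • p) ≤ M := by
    intro h hh
    rcases Finset.mem_insert.1 hh with rfl | hh
    · simpa using hM0
    · rw [Finset.mem_singleton.1 hh]
  obtain ⟨n, Q, hQ⟩ := ha.exists_dist_sub_le_stableLength hX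
    (D := D + (M + (4 * C + 6))) (by positivity)
  refine ⟨(({1, k} : Finset G) ×ˢ ({1, k} : Finset G)).image fun q => q.2⁻¹ * a ^ n * q.1,
    Q + 2 * M + 2 * dist o p, fun g => ?_⟩
  obtain ⟨h₁, hh₁, H₁⟩ := hsel (g • p)
  obtain ⟨h₂, hh₂, H₂⟩ := hsel (g⁻¹ • p)
  refine ⟨h₂⁻¹ * a ^ n * h₁, Finset.mem_image.2 ⟨(h₁, h₂), by simp [hh₁, hh₂], rfl⟩, ?_⟩
  have d₁ := hdisp h₁ hh₁
  have d₂ := hdisp h₂ hh₂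
  have i₁ : dist p (h₁⁻¹ • p) = dist p (h₁ • p) := by
    rw [← dist_smul h₁, smul_inv_smul, dist_comm]
  have i₂ : dist p (h₂⁻¹ • p) = dist p (h₂ • p) := by
    rw [← dist_smul h₂, smul_inv_smul, dist_comm]
  set g' := h₁ * g * h₂⁻¹ with hg'
  -- Passing from `h₁ • g • p` to `g' • p`, or from `h₂ • g⁻¹ • p` to `g'⁻¹ • p`, moves the point by
  -- at most `M`; the coarse Lipschitz bound controls the projection.
  have key : ∀ x x' : X, (∀ y ∈ coarseProj (cyclicOrbit a p) x, dist p y ≤ D) →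
      dist x x' ≤ M → ∃ y ∈ coarseProj (cyclicOrbit a p) x', dist p y ≤ D + (M + (4 * C + 6)) := by
    intro x x' hx hxx'
    obtain ⟨y, hy⟩ := coarseProj_nonempty ⟨p, hpA⟩ x
    obtain ⟨y', hy'⟩ := coarseProj_nonempty ⟨p, hpA⟩ x'
    exact ⟨y', hy', by
      linarith [hA.dist_proj_le hC.le hX hy hy', hx y hy, dist_triangle p y y']⟩
  have h := hQ g'
    (key _ _ H₁ (by rw [hg', mul_smul, mul_smul, dist_smul, dist_smul, i₂]; exact d₂))
    (key _ _ H₂ (by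
      rw [hg', mul_inv_rev, mul_inv_rev, inv_inv, mul_smul, mul_smul, dist_smul, dist_smul, i₁]
      exact d₁))
  have hconj : g' * a ^ n = h₁ * (g * (h₂⁻¹ * a ^ n * h₁)) * h₁⁻¹ := by
    rw [hg']; group
  rw [hconj, stableLength_conj, stableLength_eq p o] at h
  have e₁ : dist p (g • p) ≤ dist p (g' • p) + 2 * M := by
    have t₁ : dist (h₁ • p) (h₁ • g • p) = dist p (g • p) := dist_smul _ _ _
    have t₂ : dist (g' • p) (h₁ • g • p) = dist p (h₂ • p) := by
      rw [hg', mul_smul, mul_smul, dist_smul, dist_smul, dist_comm, i₂]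
    linarith [dist_triangle4 (h₁ • p) p (g' • p) (h₁ • g • p), dist_comm (h₁ • p) p]
  have e₂ : dist (g • p) (g • o) = dist o p := by rw [dist_smul, dist_comm]
  linarith [dist_triangle4 o p (g • p) (g • o)]

end ContractingElements

/-! ### Comparison of the two actions -/

section Rigidity

theorem isRoughIsometry_of_abs_le {X Y : Type*} [MetricSpace X] [MetricSpace Y] {f : X → Y}
    {f' : Y → X} {c K K' : ℝ} (h : ∀ x x', |dist (f x) (f x') - dist x x'| ≤ c)
    (hK : ∀ x, dist x (f' (f x)) ≤ K) (hK' : ∀ y, dist y (f (f' y)) ≤ K') :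
    IsRoughIsometry f := by
  -- For empty `X` the bound `h` does not force `0 ≤ c`.
  refine ⟨max c 0, ⟨le_rfl, le_max_right _ _, fun x y => ?_⟩, f', ⟨K, hK⟩, K', hK'⟩
  have h1 := abs_le.1 ((h x y).trans (le_max_left c 0))
  constructor <;> linarith [h1.1, h1.2]

theorem IsOrbitMap.isRoughIsometry {G X₁ X₂ : Type*} [Group G] [MetricSpace X₁]
    [MetricSpace X₂] [MulAction G X₁] [MulAction G X₂] {o₁ : X₁} {o₂ : X₂} {M : ℝ}
    (hM : ∀ g h : G, |dist (g • o₁) (h • o₁) - dist (g • o₂) (h • o₂)| ≤ M)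
    {ρ : MulAction.orbit G o₁ → MulAction.orbit G o₂} (hρ : IsOrbitMap o₁ o₂ ρ) :
    IsRoughIsometry ρ := by
  choose φ hφ hφρ using hρ
  have hψ : ∀ y : MulAction.orbit G o₂, ∃ g : G, g • o₂ = y := fun y => y.2
  choose ψ hψ using hψ
  refine isRoughIsometry_of_abs_le (c := M) (K := M) (K' := M)
    (f' := fun y => ⟨ψ y • o₁, ψ y, rfl⟩) (fun x x' => ?_) (fun x => ?_) fun y => ?_
  · rw [Subtype.dist_eq, Subtype.dist_eq, hφρ, hφρ, ← hφ x, ← hφ x', abs_sub_comm]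
    exact hM _ _
  -- `φ x` and `ψ (ρ x)` send `o₂` to the same point, so they send `o₁` to points at distance at
  -- most `M`.
  · have h := (abs_le.1 (hM (φ x) (ψ (ρ x)))).2
    rw [hψ, hφρ, dist_self, hφ] at h
    simpa [Subtype.dist_eq] using h
  · set x : MulAction.orbit G o₁ := ⟨ψ y • o₁, ψ y, rfl⟩ with hx
    have h := (abs_le.1 (hM (ψ y) (φ x))).1
    rw [hψ, ← hφρ, hφ, hx, dist_self, ← hx] at h
    rw [Subtype.dist_eq]
    linarith

theorem IsCobounded.exists_dist_smul_le {G X : Type*} [Group G] [MetricSpace X]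
    [MulAction G X] [IsIsometricSMul G X] (h : IsCobounded G X) (o : X) :
    ∃ K : ℝ, ∀ x : X, ∃ g : G, dist x (g • o) ≤ K := by
  obtain ⟨B, hB, hcov⟩ := h
  obtain ⟨K, hK⟩ := hB.subset_closedBall o
  refine ⟨K, fun x => ?_⟩
  obtain ⟨g, b, hb, rfl⟩ := hcov x
  exact ⟨g, by simpa [dist_smul] using hK hb⟩

variable {G X₁ X₂ : Type*} [Group G] [MetricSpace X₁] [MetricSpace X₂]
  [MulAction G X₁] [MulAction G X₂] [IsIsometricSMul G X₁] [IsIsometricSMul G X₂]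

/-- One-sided, so that it can be applied again with the two actions exchanged. -/
theorem exists_dist_le_dist_add (hX₁ : IsGeodesicSpace X₁) (hc₁ : HasContractingProperty G X₁)
    (o₁ : X₁) (o₂ : X₂) (hℓ : ∀ g : G, stableLength o₁ g ≤ stableLength o₂ g) :
    ∃ M : ℝ, ∀ g : G, dist o₁ (g • o₁) ≤ dist o₂ (g • o₂) + M := by
  obtain ⟨F, Q, hF⟩ := hc₁.exists_dist_le_stableLength hX₁ o₁
  refine ⟨∑ f ∈ F, dist o₂ (f • o₂) + Q, fun g => ?_⟩
  obtain ⟨f, hf, h⟩ := hF g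
  have h1 : dist o₂ (f • o₂) ≤ ∑ f ∈ F, dist o₂ (f • o₂) :=
    Finset.single_le_sum (f := fun f => dist o₂ (f • o₂)) (fun _ _ => dist_nonneg) hf
  have h2 : dist (g • o₂) ((g * f) • o₂) = dist o₂ (f • o₂) := by rw [mul_smul, dist_smul]
  linarith [hℓ (g * f), stableLength_le_dist o₂ (g * f),
    dist_triangle o₂ (g • o₂) ((g * f) • o₂)]

theorem exists_abs_dist_sub_dist_le (hX₁ : IsGeodesicSpace X₁) (hX₂ : IsGeodesicSpace X₂)
    (hc₁ : HasContractingProperty G X₁) (hc₂ : HasContractingProperty G X₂) (o₁ : X₁) (o₂ : X₂)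
    (hℓ : ∀ g : G, stableLength o₁ g = stableLength o₂ g) :
    ∃ M : ℝ, ∀ g h : G, |dist (g • o₁) (h • o₁) - dist (g • o₂) (h • o₂)| ≤ M := by
  obtain ⟨M₁, h₁⟩ := exists_dist_le_dist_add hX₁ hc₁ o₁ o₂ fun g => (hℓ g).le
  obtain ⟨M₂, h₂⟩ := exists_dist_le_dist_add hX₂ hc₂ o₂ o₁ fun g => (hℓ g).ge
  refine ⟨max M₁ M₂, fun g h => ?_⟩
  rw [← dist_smul g⁻¹ (g • o₁), ← dist_smul g⁻¹ (g • o₂), inv_smul_smul, inv_smul_smul,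
    ← mul_smul, ← mul_smul, abs_sub_le_iff]
  constructor
  · linarith [h₁ (g⁻¹ * h), le_max_left M₁ M₂]
  · linarith [h₂ (g⁻¹ * h), le_max_right M₁ M₂]

theorem exists_isRoughIsometry_isCoarselyEquivariant {o₁ : X₁} {o₂ : X₂} {M : ℝ}
    (hM : ∀ g h : G, |dist (g • o₁) (h • o₁) - dist (g • o₂) (h • o₂)| ≤ M)
    (h₁ : IsCobounded G X₁) (h₂ : IsCobounded G X₂) :
    ∃ f : X₁ → X₂, IsRoughIsometry f ∧ IsCoarselyEquivariant G f := by
  obtain ⟨K₁, hK₁⟩ := h₁.exists_dist_smul_le o₁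
  obtain ⟨K₂, hK₂⟩ := h₂.exists_dist_smul_le o₂
  choose φ hφ using hK₁
  choose ψ hψ using hK₂
  -- Round each point to a nearby orbit point, then apply the orbit map: `M` is the orbit map's
  -- error, `K₁` and `K₂` those of the rounding.
  refine ⟨fun x => φ x • o₂, isRoughIsometry_of_abs_le (c := M + 2 * K₁) (K := M + K₁ + K₂)
    (K' := M + K₁ + K₂) (f' := fun y => ψ y • o₁) (fun x x' => ?_) (fun x => ?_) (fun y => ?_),
    M + 2 * K₁, fun g x => ?_⟩
  · have h := abs_le.1 (hM (φ x) (φ x'))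
    have h3 := abs_le.1 (dist_dist_dist_le x x' (φ x • o₁) (φ x' • o₁))
    rw [abs_le]
    constructor <;> linarith [h.1, h.2, h3.1, h3.2, hφ x, hφ x']
  · have h := abs_le.1 (hM (φ x) (ψ (φ x • o₂)))
    linarith [h.2, hφ x, hψ (φ x • o₂), dist_triangle x (φ x • o₁) (ψ (φ x • o₂) • o₁)]
  · have h := abs_le.1 (hM (ψ y) (φ (ψ y • o₁)))
    linarith [h.1, hψ y, hφ (ψ y • o₁), dist_triangle y (ψ y • o₂) (φ (ψ y • o₁) • o₂)]
  · have h := abs_le.1 (hM (φ (g • x)) (g * φ x))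
    have h3 : dist (g • x) ((g * φ x) • o₁) = dist x (φ x • o₁) := by rw [mul_smul, dist_smul]
    rw [← mul_smul]
    linarith [h.1, hφ x, hφ (g • x),
      dist_triangle_left (φ (g • x) • o₁) ((g * φ x) • o₁) (g • x)]

end Rigidity

end MLS

theorem theorem1p1 {G X₁ X₂ : Type*} [Group G] [MetricSpace X₁] [MetricSpace X₂]
    [MulAction G X₁] [MulAction G X₂] [IsIsometricSMul G X₁] [IsIsometricSMul G X₂]
    (hX₁ : MLS.IsGeodesicSpace X₁) (hX₂ : MLS.IsGeodesicSpace X₂)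
    (hc₁ : MLS.HasContractingProperty G X₁) (hc₂ : MLS.HasContractingProperty G X₂)
    (o₁ : X₁) (o₂ : X₂)
    (hℓ : ∀ g : G, MLS.stableLength o₁ g = MLS.stableLength o₂ g) :
    BddAbove (Set.range fun p : G × G =>
        |dist (p.1 • o₁) (p.2 • o₁) - dist (p.1 • o₂) (p.2 • o₂)|) ∧
      (∃ K : ℝ, ∀ g h : G, g • o₁ = h • o₁ → dist (g • o₂) (h • o₂) ≤ K) ∧
      (∃ ρ : MulAction.orbit G o₁ → MulAction.orbit G o₂, MLS.IsOrbitMap o₁ o₂ ρ) ∧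
      (∀ ρ : MulAction.orbit G o₁ → MulAction.orbit G o₂,
        MLS.IsOrbitMap o₁ o₂ ρ → MLS.IsRoughIsometry ρ) ∧
      (MLS.IsCobounded G X₁ → MLS.IsCobounded G X₂ →
        ∃ f : X₁ → X₂, MLS.IsRoughIsometry f ∧ MLS.IsCoarselyEquivariant G f) := by
  obtain ⟨M, hM⟩ := MLS.exists_abs_dist_sub_dist_le hX₁ hX₂ hc₁ hc₂ o₁ o₂ hℓ
  refine ⟨⟨M, ?_⟩, ⟨M, fun g h hgh => ?_⟩, ?_, fun ρ hρ => hρ.isRoughIsometry hM,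
    MLS.exists_isRoughIsometry_isCoarselyEquivariant hM⟩
  · rintro _ ⟨p, rfl⟩
    exact hM p.1 p.2
  · have h1 := (abs_le.1 (hM g h)).1
    rw [hgh, dist_self] at h1
    linarith
  · have hφ : ∀ x : MulAction.orbit G o₁, ∃ g : G, g • o₁ = x := fun x => x.2
    choose φ hφ using hφ
    exact ⟨fun x => ⟨φ x • o₂, φ x, rfl⟩, fun x => ⟨φ x, hφ x, rfl⟩⟩
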